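/- Let $(\Omega,\nu)=\prod_{t=1}^n(\Omega_t,\nu_t)$ be a product of finite probability spaces, and suppose that for every $t$ the number $p_t=\min_{\omega\in\Omega_t}\nu_t(\omega)$ satisfies $0<p_t\le \frac12$. Put $\sigma_t=\sqrt{p_t(1-p_t)}$ and $\sigma_S=\prod_{t\in S}\sigma_t$ for $S\subseteq[n]$. For $f:\Omega\to\mathbb{R}$ and $J\subseteq[n]$ let $\mathrm{E}_Jf(\omega)$ be the average of $f$ over the coordinates in $J$ (drawn from $\prod_{t\in J}\nu_t$), the coordinates of $\omega$ outside $J$ being kept fixed. Let $\mathrm{L}_tf=f-\mathrm{E}_{\{t\}}f$, and let $\mathrm{L}_S$ be the composition of the (commuting) operators $\mathrm{L}_t$, $t\in S$. Let $f^{=S}=\sum_{J\subseteq S}(-1)^{|S\setminus J|}\,\mathrm{E}_{[n]\setminus J}f$ be the Efron–Stein components of $f$, and let $\mathrm{T}_\rho f=\sum_{S\subseteq[n]}\rho^{|S|}f^{=S}$ be the noise operator. Norms are taken in $L^r(\Omega,\nu)$. Then for every $f:\Omega\to\mathbb{R}$, every even integer $q>2$ and every real $\rho$ with $0\le\rho\le\frac{1}{8q^{3/2}}$,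 $$\|\mathrm{T}_\rho f\|_q^q\;\le\;\sum_{S\subseteq[n]}\sigma_S^{2-q}\,\|\mathrm{L}_Sf\|_2^q .$$ -/

import Mathlib

open MeasureTheory

noncomputable section

namespace ProductSpace

/-- The least probability of an atom of a finite probability space. -/
def minAtom {α : Type*} [MeasurableSpace α] (ν : Measure α) : ℝ :=
  ⨅ a : α, ν.real {a}

/-- `σ = √(p (1 - p))`, where `p` is the least probability of an atom. -/
def sigma {α : Type*} [MeasurableSpace α] (ν : Measure α) : ℝ :=
  √(minAtom ν * (1 - minAtom ν))

variable {n : ℕ} {Ω : Fin n → Type*} [∀ t, MeasurableSpace (Ω t)]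

/-- `σ_S`, the product of the `σ_t` over `t ∈ S`. -/
def sigmaSet (ν : ∀ t, Measure (Ω t)) (S : Finset (Fin n)) : ℝ :=
  ∏ t ∈ S, sigma (ν t)

/-- The projection `E_J`: average over the coordinates in `J` (drawn independently from the
`ν t`), the other coordinates being kept fixed. -/
def proj (ν : ∀ t, Measure (Ω t)) (J : Finset (Fin n)) (f : (∀ t, Ω t) → ℝ) :
    (∀ t, Ω t) → ℝ :=
  fun ω => ∫ y, f (J.piecewise y ω) ∂(Measure.pi ν)

/-- The Laplacian `L_t f = f - E_t f`. -/
def laplacian (ν : ∀ t, Measure (Ω t)) (t : Fin n) (f : (∀ t, Ω t) → ℝ) :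
    (∀ t, Ω t) → ℝ :=
  fun ω => f ω - proj ν {t} f ω

/-- The generalised Laplacian `L_S`: the composition of the `L_t` over `t ∈ S`
(these operators commute; the composition is taken in increasing order of the indices). -/
def laplacianSet (ν : ∀ t, Measure (Ω t)) (S : Finset (Fin n)) (f : (∀ t, Ω t) → ℝ) :
    (∀ t, Ω t) → ℝ :=
  (S.sort (· ≤ ·)).foldr (fun t g => laplacian ν t g) f

/-- The Efron–Stein component `f^{=S} = ∑_{J ⊆ S} (-1)^{|S \ J|} f^{⊆ J}`, where
`f^{⊆ J} = E_{Jᶜ} f`. -/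
def efronStein (ν : ∀ t, Measure (Ω t)) (S : Finset (Fin n)) (f : (∀ t, Ω t) → ℝ) :
    (∀ t, Ω t) → ℝ :=
  fun ω => ∑ J ∈ S.powerset, (-1 : ℝ) ^ (S \ J).card * proj ν Jᶜ f ω

/-- The noise operator `T_ρ f = ∑_S ρ^{|S|} f^{=S}`. -/
def noise (ν : ∀ t, Measure (Ω t)) (ρ : ℝ) (f : (∀ t, Ω t) → ℝ) :
    (∀ t, Ω t) → ℝ :=
  fun ω => ∑ S : Finset (Fin n), ρ ^ S.card * efronStein ν S f ω

end ProductSpace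

end

/-! Write q = 2(m+1). The noise operator is the product over t of the commuting operators E_t + ρ
L_t, so coordinates can be treated one at a time, exchanging L^q for L² in each. `mixedNorm` records
the intermediate stages. The exchange in one coordinate is `mixedNorm_step`: its price is a second
term with g replaced by L_t g and weight σ_t^(2-q). Iterating (`mixedNorm_noiseHom_le`), each
coordinate contributes either the identity or L_t with its weight, which produces the sum over S.

For one coordinate, put e = E_t g, d = L_t g, and let α, s, δ be the E_A-averages of e², ed, d².
Then E_A (e + ρd)² = α + 2ρs + ρ²δ, and `quadratic_pow_le` bounds its power m+1 by the constant and
linear terms plus δ(α^m + C^m), for any C ≥ δ. Averaging over t kills the linear term because E_t d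
= 0. Since an atom has mass at least σ_t², C = σ_t⁻² E_t δ is admissible, and it is constant in
coordinate t. Smallness of ρ enters only through qρ ≤ 1. -/

namespace ProductSpace

/-! ### Scalar inequalities. -/

theorem pow_add_mul_le_add_pow {x y : ℝ} (hx : 0 ≤ x) (hxy : 0 ≤ x + y) (m : ℕ) :
    x ^ (m + 1) + (m + 1) * x ^ m * y ≤ (x + y) ^ (m + 1) := by
  induction m with
  | zero => simp
  | succ k ih =>
    have h := mul_le_mul_of_nonneg_right ih hxy
    have h2 : 0 ≤ ((k : ℝ) + 1) * x ^ k * y ^ 2 := by positivity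
    calc x ^ (k + 1 + 1) + ((k + 1 : ℕ) + 1) * x ^ (k + 1) * y
        ≤ (x ^ (k + 1) + (k + 1) * x ^ k * y) * (x + y) := by
          push_cast
          linear_combination h2
      _ ≤ _ := by rw [pow_succ (x + y) (k + 1)]; exact h

/-- The difference y^(m+1) - x^(m+1) is (m+1) times the integral of u^m over [x, y]; by convexity
the mean of u^m there is at least its value at the midpoint, which is at least α^m. -/
theorem pow_le_pow_sub_mul {x y z α : ℝ} (hα : 0 ≤ α) (hx : 0 ≤ x) (hz : 0 ≤ z)
    (hy : y = x + z) (hxy : 2 * α ≤ x + y) (m : ℕ) :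
    x ^ (m + 1) ≤ y ^ (m + 1) - (m + 1) * α ^ m * z := by
  induction m with
  | zero => simp [hy]
  | succ k ih =>
    have hy0 : 0 ≤ y := by linarith
    have hb := pow_add_mul_le_add_pow hα (y := y - α) (by linarith) k
    rw [add_sub_cancel] at hb
    have h1 := mul_le_mul_of_nonneg_right ih hx
    have h2 : 0 ≤ ((k : ℝ) + 1) * α ^ k * (x + y - 2 * α) * z :=
      mul_nonneg (mul_nonneg (by positivity) (by linarith)) hz
    have h3 := mul_le_mul_of_nonneg_right hb hz
    have e : x ^ (k + 1 + 1) = x ^ (k + 1) * x := pow_succ _ _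
    have e' : y ^ (k + 1 + 1) = y ^ (k + 1) * (x + z) := by rw [pow_succ, ← hy]
    have e'' : α ^ (k + 1) = α ^ k * α := pow_succ _ _
    rw [e', e]
    push_cast
    rw [e''] at h3 ⊢
    nlinarith [h1, h2, h3]

/-- The part of degree at least two of the binomial expansion of `(1 + ρ) ^ q`. -/
theorem one_add_pow_sub_le_one {ρ : ℝ} {q : ℕ} (hρ : 0 ≤ ρ) (hqρ : q * ρ ≤ 1) :
    (1 + ρ) ^ q - 1 - q * ρ ≤ 1 := by
  have h0 : 0 ≤ q * ρ := by positivity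
  have h1 : (1 + ρ) ^ q ≤ Real.exp (q * ρ) := by
    rw [Real.exp_nat_mul]
    gcongr
    linarith [Real.add_one_le_exp ρ]
  have h2 := abs_le.1 (Real.abs_exp_sub_one_sub_id_le (x := q * ρ) (by rwa [abs_of_nonneg h0]))
  nlinarith

/-- Each binomial term of degree at least two in w is at most w² max(a, c)^k times its coefficient,
and these coefficients add up to the bracket in (1 + ρ). -/
theorem add_mul_pow_le {a w c ρ : ℝ} (ha : 0 ≤ a) (hw : 0 ≤ w) (hwc : w ≤ c) (hρ : 0 ≤ ρ)
    (k : ℕ) :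
    (a + ρ * w) ^ (k + 2) ≤ a ^ (k + 2) + (k + 2) * a ^ (k + 1) * (ρ * w) +
      ((1 + ρ) ^ (k + 2) - 1 - (k + 2) * ρ) * (w ^ 2 * (a ^ k + c ^ k)) := by
  have hc : 0 ≤ c := hw.trans hwc
  have key : ∀ i ∈ Finset.range (k + 1), w ^ (i + 2) * a ^ (k - i) ≤ w ^ 2 * (a ^ k + c ^ k) := by
    intro i hi
    have hi' : i ≤ k := by simpa [Nat.lt_succ_iff] using hi
    have : w ^ i * a ^ (k - i) ≤ a ^ k + c ^ k := by
      rcases le_total a c with h | h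
      · calc w ^ i * a ^ (k - i) ≤ c ^ i * c ^ (k - i) := by gcongr
          _ = c ^ k := by rw [← pow_add, Nat.add_sub_cancel' hi']
          _ ≤ _ := le_add_of_nonneg_left (by positivity)
      · calc w ^ i * a ^ (k - i) ≤ a ^ i * a ^ (k - i) := by
              gcongr
              exact hwc.trans h
          _ = a ^ k := by rw [← pow_add, Nat.add_sub_cancel' hi']
          _ ≤ _ := le_add_of_nonneg_right (by positivity)
    calc w ^ (i + 2) * a ^ (k - i) = w ^ 2 * (w ^ i * a ^ (k - i)) := by ring
      _ ≤ _ := by gcongr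
  have expand : ∀ x y : ℝ, (x + y) ^ (k + 2) = x ^ (k + 2) + (k + 2) * x ^ (k + 1) * y +
      ∑ i ∈ Finset.range (k + 1), y ^ (i + 2) * x ^ (k - i) * ((k + 2).choose (i + 2)) := by
    intro x y
    rw [add_comm x y, add_pow, Finset.sum_range_succ', Finset.sum_range_succ']
    simp only [Nat.add_sub_add_right, Nat.choose_zero_right, Nat.choose_one_right, zero_add,
      pow_zero, pow_one, Nat.sub_zero, Nat.cast_one, add_assoc, Nat.reduceAdd,
      Nat.reduceSubDiff]
    push_cast
    ring
  rw [expand a, expand 1]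
  have : ∑ i ∈ Finset.range (k + 1), (ρ * w) ^ (i + 2) * a ^ (k - i) * ((k + 2).choose (i + 2)) ≤
      (∑ i ∈ Finset.range (k + 1), ρ ^ (i + 2) * 1 ^ (k - i) * ((k + 2).choose (i + 2))) *
        (w ^ 2 * (a ^ k + c ^ k)) := by
    rw [Finset.sum_mul]
    refine Finset.sum_le_sum fun i hi => ?_
    calc _ = ρ ^ (i + 2) * ((k + 2).choose (i + 2)) * (w ^ (i + 2) * a ^ (k - i)) := by ring
      _ ≤ ρ ^ (i + 2) * ((k + 2).choose (i + 2)) * (w ^ 2 * (a ^ k + c ^ k)) := by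
        exact mul_le_mul_of_nonneg_left (key i hi) (by positivity)
      _ = _ := by ring
  refine (add_le_add_right this _).trans_eq ?_
  ring

theorem quadratic_pow_le {α δ s C ρ : ℝ} (hα : 0 ≤ α) (hδ : 0 ≤ δ) (hs : s ^ 2 ≤ α * δ)
    (hC : δ ≤ C) (hρ : 0 ≤ ρ) (m : ℕ) (hK : ((2 * (m + 1) : ℕ) : ℝ) * ρ ≤ 1) :
    (α + 2 * ρ * s + ρ ^ 2 * δ) ^ (m + 1) ≤
      α ^ (m + 1) + 2 * (m + 1) * ρ * α ^ m * s + δ * (α ^ m + C ^ m) := by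
  obtain ⟨a, ha, rfl⟩ : ∃ a : ℝ, 0 ≤ a ∧ a ^ 2 = α := ⟨√α, by positivity, Real.sq_sqrt hα⟩
  obtain ⟨w, hw, rfl⟩ : ∃ w : ℝ, 0 ≤ w ∧ w ^ 2 = δ := ⟨√δ, by positivity, Real.sq_sqrt hδ⟩
  obtain ⟨c, hc, rfl⟩ : ∃ c : ℝ, 0 ≤ c ∧ c ^ 2 = C :=
    ⟨√C, by positivity, Real.sq_sqrt (hδ.trans hC)⟩
  have hwc : w ≤ c := le_of_sq_le_sq hC hc
  have hsa : |s| ≤ a * w := abs_le_of_sq_le_sq (by rwa [mul_pow]) (by positivity)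
  obtain ⟨hs1, hs2⟩ := abs_le.1 hsa
  -- The square (a + ρw)² is the extreme case s = aw of Cauchy–Schwarz. The subtracted term turns
  -- its linear term, in aw, into exactly the one in s, so the sign of s is not lost.
  have h1 := pow_le_pow_sub_mul (x := a ^ 2 + 2 * ρ * s + ρ ^ 2 * w ^ 2) (y := (a + ρ * w) ^ 2)
    (z := 2 * ρ * (a * w - s)) (α := a ^ 2) (by positivity)
    (by nlinarith [sq_nonneg (a - ρ * w)])
    (mul_nonneg (by positivity) (by linarith)) (by ring)
    (by nlinarith [sq_nonneg (ρ * w), mul_nonneg hρ (neg_le_iff_add_nonneg.1 hs1)]) m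
  have h2 := add_mul_pow_le ha hw hwc hρ (2 * m)
  have h3 := one_add_pow_sub_le_one hρ hK
  have h4 : ((1 + ρ) ^ (2 * m + 2) - 1 - ((2 * m : ℕ) + 2) * ρ) *
      (w ^ 2 * (a ^ (2 * m) + c ^ (2 * m))) ≤ w ^ 2 * (a ^ (2 * m) + c ^ (2 * m)) := by
    refine mul_le_of_le_one_left (by positivity) ?_
    push_cast at h3 ⊢
    linear_combination h3
  simp only [← pow_mul] at h1 ⊢
  push_cast at h2 h4
  have e : (2 * (m + 1)) = 2 * m + 2 := by ring
  rw [e] at h1 ⊢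
  have e' : a ^ (2 * m + 1) = a ^ (2 * m) * a := pow_succ _ _
  rw [e'] at h2
  linear_combination h1 + h2 + h4

set_option linter.unusedSectionVars false

/-! ### Averaging operators E_J. -/

section Projections

variable {n : ℕ} {Ω : Fin n → Type*} [∀ t, Fintype (Ω t)] [∀ t, MeasurableSpace (Ω t)]
  [∀ t, MeasurableSingletonClass (Ω t)] (ν : ∀ t, Measure (Ω t)) [∀ t, IsProbabilityMeasure (ν t)]

theorem integrable_pi (f : (∀ t, Ω t) → ℝ) : Integrable f (Measure.pi ν) :=
  Integrable.of_finite

/-- Gluing two independent samples along J gives a sample of the product measure; this is what makes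
successive averages compose. -/
theorem measurePreserving_piecewise (J : Finset (Fin n)) :
    MeasurePreserving (fun z : (∀ t, Ω t) × (∀ t, Ω t) => J.piecewise z.1 z.2)
      ((Measure.pi ν).prod (Measure.pi ν)) (Measure.pi ν) := by
  refine ⟨measurable_of_finite _, (Measure.pi_eq fun s _ => ?_).symm⟩
  rw [Measure.map_apply (measurable_of_finite _) (Set.toFinite _).measurableSet]
  have : (fun z : (∀ t, Ω t) × (∀ t, Ω t) => J.piecewise z.1 z.2) ⁻¹' Set.univ.pi s =
      (Set.univ.pi (J.piecewise s fun _ => Set.univ)) ×ˢ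
        (Set.univ.pi (J.piecewise (fun _ => Set.univ) s)) := by
    ext z
    simp only [Set.mem_preimage, Set.mem_pi, Set.mem_univ, true_implies, Set.mem_prod,
      ← forall_and]
    refine forall_congr' fun t => ?_
    by_cases h : t ∈ J <;> simp [h]
  rw [this, Measure.prod_prod, Measure.pi_pi, Measure.pi_pi, ← Finset.prod_mul_distrib]
  refine Finset.prod_congr rfl fun t _ => ?_
  by_cases h : t ∈ J <;> simp [h]

theorem integral_integral_piecewise (J : Finset (Fin n)) (f : (∀ t, Ω t) → ℝ) :
    ∫ ω, ∫ y, f (J.piecewise y ω) ∂(Measure.pi ν) ∂(Measure.pi ν) = ∫ ω, f ω ∂(Measure.pi ν) := by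
  have h := integral_map (μ := (Measure.pi ν).prod (Measure.pi ν))
    (φ := fun z : (∀ t, Ω t) × (∀ t, Ω t) => J.piecewise z.1 z.2)
    (measurable_of_finite _).aemeasurable (f := f) (measurable_of_finite _).aestronglyMeasurable
  rw [(measurePreserving_piecewise ν J).map_eq, integral_prod_symm _ Integrable.of_finite] at h
  exact h.symm

theorem integral_proj (J : Finset (Fin n)) (f : (∀ t, Ω t) → ℝ) :
    ∫ ω, proj ν J f ω ∂(Measure.pi ν) = ∫ ω, f ω ∂(Measure.pi ν) :=
  integral_integral_piecewise ν J f

theorem proj_proj (J K : Finset (Fin n)) (f : (∀ t, Ω t) → ℝ) :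
    proj ν J (proj ν K f) = proj ν (J ∪ K) f := by
  funext ω
  have h := integral_integral_piecewise ν K fun y => f ((J ∪ K).piecewise y ω)
  simp only [proj]
  rw [← h]
  refine integral_congr_ae (.of_forall fun y => integral_congr_ae (.of_forall fun z => ?_))
  refine congrArg f (funext fun t => ?_)
  by_cases h1 : t ∈ J <;> by_cases h2 : t ∈ K <;> simp [h1, h2]

theorem proj_comm (J K : Finset (Fin n)) (f : (∀ t, Ω t) → ℝ) :
    proj ν J (proj ν K f) = proj ν K (proj ν J f) := by
  rw [proj_proj, proj_proj, Finset.union_comm]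

@[simp]
theorem proj_empty (f : (∀ t, Ω t) → ℝ) : proj ν ∅ f = f := by
  funext ω
  simp [proj]

theorem proj_univ (f : (∀ t, Ω t) → ℝ) (ω : ∀ t, Ω t) :
    proj ν Finset.univ f ω = ∫ y, f y ∂(Measure.pi ν) := by
  simp [proj]

theorem proj_add (J : Finset (Fin n)) (f g : (∀ t, Ω t) → ℝ) :
    proj ν J (f + g) = proj ν J f + proj ν J g := by
  funext ω
  exact integral_add (integrable_pi ν _) (integrable_pi ν _)

theorem proj_smul (J : Finset (Fin n)) (c : ℝ) (f : (∀ t, Ω t) → ℝ) :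
    proj ν J (c • f) = c • proj ν J f := by
  funext ω
  exact integral_const_mul c _

/-- The projection `E_J` as a linear endomorphism of the space of functions. -/
noncomputable def projHom (J : Finset (Fin n)) : Module.End ℝ ((∀ t, Ω t) → ℝ) where
  toFun := proj ν J
  map_add' := proj_add ν J
  map_smul' := proj_smul ν J

theorem projHom_mul (J K : Finset (Fin n)) : projHom ν J * projHom ν K = projHom ν (J ∪ K) :=
  LinearMap.ext fun f => proj_proj ν J K f

theorem proj_sub (J : Finset (Fin n)) (f g : (∀ t, Ω t) → ℝ) :
    proj ν J (f - g) = proj ν J f - proj ν J g :=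
  map_sub (projHom ν J) f g

theorem proj_mono (J : Finset (Fin n)) {f g : (∀ t, Ω t) → ℝ} (h : f ≤ g) :
    proj ν J f ≤ proj ν J g :=
  fun _ => integral_mono (integrable_pi ν _) (integrable_pi ν _) fun _ => h _

theorem proj_nonneg (J : Finset (Fin n)) {f : (∀ t, Ω t) → ℝ} (h : 0 ≤ f) : 0 ≤ proj ν J f :=
  fun _ => integral_nonneg fun y => h (J.piecewise y _)

/-- Functions in the range of `E_J` are scalars for `E_J`. -/
theorem proj_proj_mul (J : Finset (Fin n)) (u v : (∀ t, Ω t) → ℝ) :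
    proj ν J (proj ν J u * v) = proj ν J u * proj ν J v := by
  funext ω
  have : ∀ y, proj ν J u (J.piecewise y ω) = proj ν J u ω := fun y => by
    simp only [proj, Finset.piecewise_piecewise_of_subset_right subset_rfl]
  rw [Pi.mul_apply]
  conv_lhs => simp only [proj, Pi.mul_apply]
  rw [show proj ν J v ω = ∫ y, v (J.piecewise y ω) ∂(Measure.pi ν) from rfl, ← integral_const_mul]
  refine integral_congr_ae (.of_forall fun y => ?_)
  exact congrArg (· * v (J.piecewise y ω)) (this y)

theorem proj_mul_of_fixed {J : Finset (Fin n)} {u : (∀ t, Ω t) → ℝ} (hu : proj ν J u = u)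
    (v : (∀ t, Ω t) → ℝ) : proj ν J (u * v) = u * proj ν J v := by
  have := proj_proj_mul ν J u v
  rwa [hu] at this

theorem proj_one (J : Finset (Fin n)) : proj ν J (1 : (∀ t, Ω t) → ℝ) = 1 := by
  funext ω
  simp [proj]

theorem proj_pow_of_fixed {J : Finset (Fin n)} {u : (∀ t, Ω t) → ℝ} (hu : proj ν J u = u)
    (m : ℕ) : proj ν J (u ^ m) = u ^ m := by
  induction m with
  | zero => simp [proj_one]
  | succ k ih => rw [pow_succ', proj_mul_of_fixed ν hu, ih]

/-- The Cauchy–Schwarz inequality for `E_J`. -/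
theorem proj_mul_sq_le (J : Finset (Fin n)) (u v : (∀ t, Ω t) → ℝ) (ω : ∀ t, Ω t) :
    proj ν J (u * v) ω ^ 2 ≤ proj ν J (u ^ 2) ω * proj ν J (v ^ 2) ω := by
  have h : ∀ x : ℝ, 0 ≤ proj ν J (v ^ 2) ω * (x * x) + 2 * proj ν J (u * v) ω * x +
      proj ν J (u ^ 2) ω := by
    intro x
    have h0 : (0 : ℝ) ≤ proj ν J ((u + x • v) ^ 2) ω :=
      proj_nonneg ν J (fun ω => sq_nonneg ((u + x • v) ω)) ω
    have e : (u + x • v) ^ 2 = u ^ 2 + (2 * x) • (u * v) + (x * x) • v ^ 2 := by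
      funext ω
      simp only [Pi.add_apply, Pi.pow_apply, Pi.smul_apply, Pi.mul_apply, smul_eq_mul]
      ring
    rw [e, proj_add, proj_add, proj_smul, proj_smul] at h0
    simp only [Pi.add_apply, Pi.smul_apply, smul_eq_mul] at h0
    linarith
  have := discrim_le_zero h
  rw [discrim] at this
  linarith

theorem proj_singleton (t : Fin n) (f : (∀ t, Ω t) → ℝ) (ω : ∀ t, Ω t) :
    proj ν {t} f ω = ∑ x, (ν t).real {x} * f (Function.update ω t x) := by
  have h := integral_map (μ := Measure.pi ν) (φ := Function.eval t)
    (measurable_of_finite _).aemeasurable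
    (f := fun x => f (Function.update ω t x)) (measurable_of_finite _).aestronglyMeasurable
  rw [(measurePreserving_eval ν t).map_eq, integral_fintype Integrable.of_finite] at h
  simpa [proj, Finset.piecewise_singleton] using h.symm

theorem minAtom_mul_le_proj (t : Fin n) {f : (∀ t, Ω t) → ℝ} (hf : 0 ≤ f) (ω : ∀ t, Ω t) :
    minAtom (ν t) * f ω ≤ proj ν {t} f ω := by
  rw [proj_singleton]
  calc minAtom (ν t) * f ω
      ≤ (ν t).real {ω t} * f (Function.update ω t (ω t)) := by
        rw [Function.update_eq_self]
        exact mul_le_mul_of_nonneg_right (ciInf_le (Set.finite_range _).bddBelow _) (hf ω)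
    _ ≤ _ := Finset.single_le_sum
      (f := fun x => (ν t).real {x} * f (Function.update ω t x))
      (fun x _ => mul_nonneg measureReal_nonneg (hf _)) (Finset.mem_univ _)

/-- A nonnegative function is at most its average over coordinate `t` divided by `σ_t²`. -/
theorem sigma_sq_mul_le_proj (t : Fin n) (hp : 0 < minAtom (ν t) ∧ minAtom (ν t) ≤ 1 / 2)
    {f : (∀ t, Ω t) → ℝ} (hf : 0 ≤ f) (ω : ∀ t, Ω t) :
    sigma (ν t) ^ 2 * f ω ≤ proj ν {t} f ω := by
  -- It is enough that σ_t² = p(1 - p) ≤ p.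
  refine le_trans (mul_le_mul_of_nonneg_right ?_ (hf ω)) (minAtom_mul_le_proj ν t hf ω)
  rw [sigma, Real.sq_sqrt (mul_nonneg hp.1.le (by linarith))]
  nlinarith

end Projections

/-! ### Laplacians, Efron–Stein components and the noise operator in the algebra of endomorphisms.
-/

section Operators

variable {n : ℕ} {Ω : Fin n → Type*} [∀ t, Fintype (Ω t)] [∀ t, MeasurableSpace (Ω t)]
  [∀ t, MeasurableSingletonClass (Ω t)] (ν : ∀ t, Measure (Ω t)) [∀ t, IsProbabilityMeasure (ν t)]

/-- The Laplacian `L_t` as a linear endomorphism. -/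
noncomputable def lapHom (t : Fin n) : Module.End ℝ ((∀ t, Ω t) → ℝ) :=
  1 - projHom ν {t}

/-- The generalised Laplacian `L_S`, expanded as `∑_{J ⊆ S} (-1)^{|J|} E_J`. -/
noncomputable def lapSetHom (S : Finset (Fin n)) : Module.End ℝ ((∀ t, Ω t) → ℝ) :=
  ∑ J ∈ S.powerset, (-1 : ℝ) ^ J.card • projHom ν J

theorem projHom_commute (J K : Finset (Fin n)) : Commute (projHom ν J) (projHom ν K) := by
  rw [Commute, SemiconjBy, projHom_mul, projHom_mul, Finset.union_comm]

theorem projHom_commute_lapSetHom (J S : Finset (Fin n)) :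
    Commute (projHom ν J) (lapSetHom ν S) :=
  Commute.sum_right _ _ _ fun K _ => (projHom_commute ν J K).smul_right _

@[simp]
theorem projHom_empty : projHom ν ∅ = 1 :=
  LinearMap.ext fun f => proj_empty ν f

@[simp]
theorem lapSetHom_empty : lapSetHom ν ∅ = 1 := by
  simp [lapSetHom]

theorem lapSetHom_insert {t : Fin n} {S : Finset (Fin n)} (ht : t ∉ S) :
    lapSetHom ν (insert t S) = lapHom ν t * lapSetHom ν S := by
  rw [lapSetHom, Finset.sum_powerset_insert ht, lapHom, sub_mul, one_mul, ← lapSetHom,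
    sub_eq_add_neg]
  congr 1
  rw [lapSetHom, Finset.mul_sum, ← Finset.sum_neg_distrib]
  refine Finset.sum_congr rfl fun J hJ => ?_
  rw [Finset.card_insert_of_notMem fun h => ht (Finset.mem_powerset.1 hJ h), mul_smul_comm,
    projHom_mul, ← Finset.insert_eq, pow_succ, mul_neg_one]
  exact neg_smul ((-1 : ℝ) ^ J.card) (projHom ν (insert t J))

theorem lapHom_commute_lapSetHom (t : Fin n) (S : Finset (Fin n)) :
    Commute (lapHom ν t) (lapSetHom ν S) :=
  (Commute.one_left _).sub_left (projHom_commute_lapSetHom ν {t} S)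

/-- The expanded form does not depend on an order of composition, so it suits induction over finite
sets. -/
theorem laplacianSet_eq (S : Finset (Fin n)) (f : (∀ t, Ω t) → ℝ) :
    laplacianSet ν S f = lapSetHom ν S f := by
  have key : ∀ l : List (Fin n), l.Nodup →
      l.foldr (fun t g => laplacian ν t g) f = lapSetHom ν l.toFinset f := by
    intro l hl
    induction l with
    | nil => simp
    | cons t l ih =>
      rw [List.nodup_cons] at hl
      rw [List.foldr_cons, ih hl.2, List.toFinset_cons, lapSetHom_insert ν (by simpa using hl.1)]
      rfl
  rw [laplacianSet, key _ (Finset.sort_nodup _ _), Finset.sort_toFinset]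

theorem efronStein_eq (S : Finset (Fin n)) (f : (∀ t, Ω t) → ℝ) :
    efronStein ν S f = (lapSetHom ν S * projHom ν Sᶜ) f := by
  funext ω
  rw [efronStein, lapSetHom, Finset.sum_mul, LinearMap.sum_apply, Finset.sum_apply]
  -- Reindexing by J ↦ S \ J matches the signs, and Jᶜ = (S \ J) ∪ Sᶜ splits off the common factor
  -- E_{Sᶜ}.
  refine Finset.sum_bij' (fun J _ => S \ J) (fun J _ => S \ J) ?_ ?_ ?_ ?_ ?_
  · simp
  · simp
  · exact fun J hJ => Finset.sdiff_sdiff_eq_self (Finset.mem_powerset.1 hJ)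
  · exact fun J hJ => Finset.sdiff_sdiff_eq_self (Finset.mem_powerset.1 hJ)
  · intro J hJ
    have hJ := Finset.mem_powerset.1 hJ
    have : Jᶜ = S \ J ∪ Sᶜ := by
      ext t
      have := @hJ t
      simp only [Finset.mem_compl, Finset.mem_union, Finset.mem_sdiff]
      tauto
    rw [smul_mul_assoc, projHom_mul, this]
    rfl

/-- The noise operator acting on the coordinates in `B` only. -/
noncomputable def noiseHom (ρ : ℝ) (B : Finset (Fin n)) : Module.End ℝ ((∀ t, Ω t) → ℝ) :=
  ∑ S ∈ B.powerset, ρ ^ S.card • (lapSetHom ν S * projHom ν (B \ S))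

theorem noise_eq (ρ : ℝ) (f : (∀ t, Ω t) → ℝ) :
    noise ν ρ f = noiseHom ν ρ Finset.univ f := by
  funext ω
  simp [noise, noiseHom, efronStein_eq, Finset.compl_eq_univ_sdiff]

@[simp]
theorem noiseHom_empty (ρ : ℝ) : noiseHom ν ρ ∅ = 1 := by
  simp [noiseHom]

theorem projHom_commute_noiseHom (ρ : ℝ) (J B : Finset (Fin n)) :
    Commute (projHom ν J) (noiseHom ν ρ B) :=
  Commute.sum_right _ _ _ fun S _ =>
    ((projHom_commute_lapSetHom ν J S).mul_right (projHom_commute ν J _)).smul_right _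

theorem lapHom_commute_noiseHom (ρ : ℝ) (t : Fin n) (B : Finset (Fin n)) :
    Commute (lapHom ν t) (noiseHom ν ρ B) :=
  (Commute.one_left _).sub_left (projHom_commute_noiseHom ν ρ {t} B)

/-- The tensor structure of the noise operator: sets avoiding t give the factor E_t, sets containing
t give ρ L_t. -/
theorem noiseHom_insert (ρ : ℝ) {t : Fin n} {B : Finset (Fin n)} (ht : t ∉ B) :
    noiseHom ν ρ (insert t B) = (projHom ν {t} + ρ • lapHom ν t) * noiseHom ν ρ B := by
  rw [noiseHom, Finset.sum_powerset_insert ht, add_mul]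
  congr 1
  · rw [noiseHom, Finset.mul_sum]
    refine Finset.sum_congr rfl fun S hS => ?_
    have htS : t ∉ S := fun h => ht (Finset.mem_powerset.1 hS h)
    rw [mul_smul_comm, ← mul_assoc, (projHom_commute_lapSetHom ν {t} S).eq, mul_assoc,
      projHom_mul, ← Finset.insert_eq, Finset.insert_sdiff_of_notMem _ htS]
  · rw [noiseHom, Finset.mul_sum]
    refine Finset.sum_congr rfl fun S hS => ?_
    have htS : t ∉ S := fun h => ht (Finset.mem_powerset.1 hS h)
    rw [Finset.card_insert_of_notMem htS, lapSetHom_insert ν htS,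
      Finset.insert_sdiff_insert, Finset.sdiff_insert_of_notMem ht, mul_smul_comm, smul_mul_assoc,
      smul_smul, mul_assoc, pow_succ]

theorem proj_laplacian (t : Fin n) (f : (∀ t, Ω t) → ℝ) : proj ν {t} (laplacian ν t f) = 0 := by
  change proj ν {t} (f - proj ν {t} f) = 0
  rw [proj_sub, proj_proj, Finset.union_self, sub_self]

end Operators

/-! ### Exchanging L^q for L² one coordinate at a time. -/

section MixedNorm

variable {n : ℕ} {Ω : Fin n → Type*} [∀ t, Fintype (Ω t)] [∀ t, MeasurableSpace (Ω t)]
  [∀ t, MeasurableSingletonClass (Ω t)] (ν : ∀ t, Measure (Ω t)) [∀ t, IsProbabilityMeasure (ν t)]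

/-- The `2m`-th power of the mixed norm: `L²` in the coordinates in `A` and `L^{2m}` in the
others. -/
noncomputable def mixedNorm (m : ℕ) (A : Finset (Fin n)) (g : (∀ t, Ω t) → ℝ) : ℝ :=
  ∫ ω, proj ν A (g ^ 2) ω ^ m ∂(Measure.pi ν)

/-- Replacing the `L^{2m}`-norm by the `L²`-norm in one coordinate. -/
theorem mixedNorm_step {ρ : ℝ} (hρ : 0 ≤ ρ) (m : ℕ) (hK : ((2 * (m + 1) : ℕ) : ℝ) * ρ ≤ 1)
    (A : Finset (Fin n)) (t : Fin n) (hp : 0 < minAtom (ν t) ∧ minAtom (ν t) ≤ 1 / 2)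
    (g : (∀ t, Ω t) → ℝ) :
    mixedNorm ν (m + 1) A (proj ν {t} g + ρ • laplacian ν t g) ≤
      mixedNorm ν (m + 1) (insert t A) g +
        ((sigma (ν t) ^ 2) ^ m)⁻¹ * mixedNorm ν (m + 1) (insert t A) (laplacian ν t g) := by
  have hσ : 0 < sigma (ν t) ^ 2 := by
    rw [sigma, Real.sq_sqrt (mul_nonneg hp.1.le (by linarith))]
    exact mul_pos hp.1 (by linarith)
  set e := proj ν {t} g with he
  set d := laplacian ν t g with hd
  have hed : g = e + d := by
    rw [he, hd]
    funext ω
    simp [laplacian]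
  have hee : proj ν {t} e = e := by rw [he, proj_proj, Finset.union_self]
  have hde : proj ν {t} d = 0 := proj_laplacian ν t g
  set α := proj ν A (e ^ 2) with hα
  set s := proj ν A (e * d) with hs
  set δ := proj ν A (d ^ 2) with hδ
  set D := proj ν (insert t A) (d ^ 2) with hD
  have hins : ∀ h : (∀ t, Ω t) → ℝ, proj ν (insert t A) h = proj ν {t} (proj ν A h) := fun h => by
    rw [proj_proj, ← Finset.insert_eq]
  have hα_fix : proj ν {t} α = α := by
    rw [hα, proj_comm, proj_pow_of_fixed ν hee]
  have hs_zero : proj ν {t} s = 0 := by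
    rw [hs, proj_comm, proj_mul_of_fixed ν hee, hde, mul_zero]
    exact map_zero (projHom ν A)
  have hδD : proj ν {t} δ = D := by rw [hδ, hD, hins]
  have hD_fix : proj ν {t} D = D := by rw [← hδD, proj_proj, Finset.union_self]
  have hα0 : 0 ≤ α := proj_nonneg ν A fun ω => sq_nonneg (e ω)
  have hδ0 : 0 ≤ δ := proj_nonneg ν A fun ω => sq_nonneg (d ω)
  have hD0 : 0 ≤ D := proj_nonneg ν _ fun ω => sq_nonneg (d ω)
  have hpyth : proj ν (insert t A) (g ^ 2) = α + D := by
    have : g ^ 2 = e ^ 2 + (2 : ℝ) • (e * d) + d ^ 2 := by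
      rw [hed]
      funext ω
      simp only [Pi.add_apply, Pi.pow_apply, Pi.smul_apply, Pi.mul_apply, smul_eq_mul]
      ring
    rw [hins, this, proj_add ν A, proj_add ν A, proj_smul, proj_add, proj_add, proj_smul, ← hα, ← hs,
      ← hδ, hα_fix, hs_zero, hδD]
    simp
  have hexp : proj ν A ((e + ρ • d) ^ 2) = α + (2 * ρ) • s + (ρ ^ 2) • δ := by
    have : (e + ρ • d) ^ 2 = e ^ 2 + (2 * ρ) • (e * d) + (ρ ^ 2) • d ^ 2 := by
      funext ω
      simp only [Pi.add_apply, Pi.pow_apply, Pi.smul_apply, Pi.mul_apply, smul_eq_mul]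
      ring
    rw [this, proj_add, proj_add, proj_smul, proj_smul]
  -- A majorant of δ that is fixed by E_t, so that its powers can be pulled out of the average over
  -- t.
  set C := (sigma (ν t) ^ 2)⁻¹ • D with hC
  have hC_fix : proj ν {t} C = C := by rw [hC, proj_smul, hD_fix]
  have hδC : δ ≤ C := fun ω => by
    rw [hC, Pi.smul_apply, smul_eq_mul, ← div_eq_inv_mul, le_div_iff₀' hσ, ← hδD]
    exact sigma_sq_mul_le_proj ν t hp hδ0 ω
  have hfix : ∀ k : ℕ, proj ν {t} (α ^ k + C ^ k) = α ^ k + C ^ k := fun k => by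
    rw [proj_add, proj_pow_of_fixed ν hα_fix, proj_pow_of_fixed ν hC_fix]
  have hbound : (proj ν A ((e + ρ • d) ^ 2)) ^ (m + 1) ≤
      α ^ (m + 1) + (2 * (m + 1) * ρ) • (α ^ m * s) + (α ^ m + C ^ m) * δ := by
    intro ω
    rw [hexp]
    have := quadratic_pow_le (hα0 ω) (hδ0 ω) (proj_mul_sq_le ν A e d ω) (hδC ω) hρ m hK
    simp only [Pi.add_apply, Pi.pow_apply, Pi.smul_apply, Pi.mul_apply, smul_eq_mul]
    exact this.trans_eq (by ring)
  have havg : proj ν {t} ((proj ν A ((e + ρ • d) ^ 2)) ^ (m + 1)) ≤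
      (α + D) ^ (m + 1) + ((sigma (ν t) ^ 2) ^ m)⁻¹ • D ^ (m + 1) := by
    refine (proj_mono ν {t} hbound).trans ?_
    -- The cross term vanishes here: α^m comes out of E_t, leaving E_t s = 0. Likewise δ becomes D.
    rw [proj_add, proj_add, proj_smul, proj_mul_of_fixed ν (proj_pow_of_fixed ν hα_fix m),
      proj_mul_of_fixed ν (hfix m), hs_zero, hδD, proj_pow_of_fixed ν hα_fix]
    intro ω
    simp only [Pi.add_apply, Pi.pow_apply, Pi.smul_apply, Pi.mul_apply, smul_eq_mul, hC,
      Pi.zero_apply, mul_pow, inv_pow]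
    -- The term α^m D is absorbed by (α + D)^(m+1), which has room for m + 1 copies of it; `h2`
    -- discards the other m. The term C^m D is σ_t^(-2m) D^(m+1).
    have h1 := pow_add_mul_le_add_pow (hα0 ω) (add_nonneg (hα0 ω) (hD0 ω)) m
    have h2 : 0 ≤ m * (α ω ^ m * D ω) :=
      mul_nonneg (Nat.cast_nonneg m) (mul_nonneg (pow_nonneg (hα0 ω) m) (hD0 ω))
    rw [pow_succ (D ω) m]
    linear_combination h1 + h2
  have hint := integral_mono (integrable_pi ν _) (integrable_pi ν _) havg
  rw [integral_proj] at hint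
  refine hint.trans_eq ?_
  rw [mixedNorm, mixedNorm, hpyth, ← integral_const_mul, ← integral_add (integrable_pi ν _)
    (integrable_pi ν _)]
  rfl

/-- Both A and f vary in the induction: treating t moves it from B to A, and the second term of
`mixedNorm_step` replaces f by L_t f. The two terms account for the sets S without t and with t. -/
theorem mixedNorm_noiseHom_le (hp : ∀ t, 0 < minAtom (ν t) ∧ minAtom (ν t) ≤ 1 / 2) {ρ : ℝ}
    (hρ : 0 ≤ ρ) (m : ℕ) (hK : ((2 * (m + 1) : ℕ) : ℝ) * ρ ≤ 1) (B : Finset (Fin n)) :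
    ∀ (A : Finset (Fin n)) (f : (∀ t, Ω t) → ℝ),
      mixedNorm ν (m + 1) A (noiseHom ν ρ B f) ≤
        ∑ S ∈ B.powerset, ((sigmaSet ν S ^ 2) ^ m)⁻¹ *
          mixedNorm ν (m + 1) (A ∪ B) (lapSetHom ν S f) := by
  induction B using Finset.induction_on with
  | empty => simp [sigmaSet]
  | insert t B ht ih =>
    intro A f
    have hunion : A ∪ insert t B = insert t A ∪ B := by
      rw [Finset.union_insert, Finset.insert_union]
    have hcomm : laplacian ν t (noiseHom ν ρ B f) = noiseHom ν ρ B (lapHom ν t f) :=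
      LinearMap.congr_fun (lapHom_commute_noiseHom ν ρ t B).eq f
    have hstep := mixedNorm_step ν hρ m hK A t (hp t) (noiseHom ν ρ B f)
    rw [hcomm] at hstep
    rw [noiseHom_insert ν ρ ht, Finset.sum_powerset_insert ht, hunion]
    refine le_trans (le_of_eq_of_le ?_ hstep) (add_le_add (ih _ _) ?_)
    · rw [← hcomm]
      rfl
    · refine (mul_le_mul_of_nonneg_left (ih _ _) (by positivity)).trans_eq ?_
      rw [Finset.mul_sum]
      refine Finset.sum_congr rfl fun S hS => ?_
      have htS : t ∉ S := fun h => ht (Finset.mem_powerset.1 hS h)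
      rw [lapSetHom_insert ν htS, (lapHom_commute_lapSetHom ν t S).eq, sigmaSet, sigmaSet,
        Finset.prod_insert htS, mul_pow, mul_pow, mul_inv, mul_assoc]
      rfl

theorem lpNorm_two_mul_pow (m : ℕ) (g : (∀ t, Ω t) → ℝ) :
    lpNorm g ((2 * (m + 1) : ℕ) : ENNReal) (Measure.pi ν) ^ (2 * (m + 1)) =
      ∫ ω, (g ω ^ 2) ^ (m + 1) ∂(Measure.pi ν) := by
  rw [lpNorm_eq_integral_norm_rpow_toReal (by positivity)
    (ENNReal.natCast_ne_top _) (measurable_of_finite _).aestronglyMeasurable, ENNReal.toReal_natCast,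
    Real.rpow_inv_natCast_pow (integral_nonneg fun ω => by positivity) (by simp)]
  refine integral_congr_ae (.of_forall fun ω => ?_)
  simp only [Real.rpow_natCast, pow_mul, Real.norm_eq_abs, sq_abs]

theorem mixedNorm_empty (m : ℕ) (g : (∀ t, Ω t) → ℝ) :
    mixedNorm ν (m + 1) ∅ g =
      lpNorm g ((2 * (m + 1) : ℕ) : ENNReal) (Measure.pi ν) ^ (2 * (m + 1)) := by
  rw [lpNorm_two_mul_pow, mixedNorm, proj_empty]
  rfl

theorem mixedNorm_univ (m : ℕ) (g : (∀ t, Ω t) → ℝ) :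
    mixedNorm ν (m + 1) Finset.univ g = lpNorm g 2 (Measure.pi ν) ^ (2 * (m + 1)) := by
  -- The case m = 0 is the squared L² norm; averaging over all coordinates yields this constant, so
  -- the outer integral is trivial.
  have h := lpNorm_two_mul_pow ν 0 g
  norm_num at h
  rw [pow_mul, h, mixedNorm]
  simp only [proj_univ]
  simp

end MixedNorm

end ProductSpace

theorem mainTheorem10 {n : ℕ} {Ω : Fin n → Type*} [∀ t, Fintype (Ω t)]
    [∀ t, MeasurableSpace (Ω t)] [∀ t, MeasurableSingletonClass (Ω t)]
    (ν : ∀ t, Measure (Ω t)) [∀ t, IsProbabilityMeasure (ν t)]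
    (hp : ∀ t, 0 < ProductSpace.minAtom (ν t) ∧ ProductSpace.minAtom (ν t) ≤ 1 / 2)
    (f : (∀ t, Ω t) → ℝ) (q : ℕ) (hq : 2 < q) (hq_even : Even q)
    (ρ : ℝ) (hρ_nonneg : 0 ≤ ρ) (hρ : ρ ≤ 1 / (8 * (q : ℝ) ^ (3 / 2 : ℝ))) :
    lpNorm (ProductSpace.noise ν ρ f) q (Measure.pi ν) ^ q ≤
      ∑ S : Finset (Fin n), ProductSpace.sigmaSet ν S ^ (2 - (q : ℤ)) *
        lpNorm (ProductSpace.laplacianSet ν S f) 2 (Measure.pi ν) ^ q := by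
  have hq1 : (1 : ℝ) ≤ q := by exact_mod_cast (by omega : 1 ≤ q)
  -- Since q ≥ 1, q ≤ q^(3/2), so qρ is in fact at most 1/8.
  have hqρ : q * ρ ≤ 1 := by
    have h1 : (q : ℝ) ≤ (q : ℝ) ^ (3 / 2 : ℝ) := by
      simpa using Real.rpow_le_rpow_of_exponent_le hq1 (by norm_num : (1 : ℝ) ≤ 3 / 2)
    have h2 := (le_div_iff₀ (by positivity)).1 hρ
    nlinarith [mul_le_mul_of_nonneg_right h1 hρ_nonneg]
  obtain ⟨m, rfl⟩ : ∃ m, q = 2 * (m + 1) := by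
    obtain ⟨k, hk⟩ := hq_even
    exact ⟨k - 1, by omega⟩
  have h := ProductSpace.mixedNorm_noiseHom_le ν hp hρ_nonneg m hqρ Finset.univ ∅ f
  rw [← ProductSpace.noise_eq, ProductSpace.mixedNorm_empty, Finset.powerset_univ,
    Finset.empty_union] at h
  refine h.trans_eq (Finset.sum_congr rfl fun S _ => ?_)
  rw [ProductSpace.mixedNorm_univ, ProductSpace.laplacianSet_eq, ← pow_mul]
  congr 1
  -- The weight (σ_S²)^(-m) is σ_S^(2-q), because q - 2 = 2m.
  rw [show (2 : ℤ) - ((2 * (m + 1) : ℕ) : ℤ) = -((2 * m : ℕ) : ℤ) by push_cast; ring, zpow_neg,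
    zpow_natCast]
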